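/- **Theorem (Token Variance Reduction).** Let $n,m,K,d$ be integers with $m\ge 1$ and $1\le K\le n$. Let $\sigma>0$ and, for $i\in[n]$, $j\in[m]$, let $f_{ij}:\mathbb R^d\to\mathbb R$ be convex and $L_{ij}$-smooth (differentiable with $L_{ij}$-Lipschitz gradient). Let $\theta_\star$ minimize $\sum_{i=1}^n\big[\sum_{j=1}^m f_{ij}(\theta)+\frac{\sigma}{2}\|\theta\|^2\big]$. Put $$\tilde\sigma=\frac{n\sigma}{n+K},\quad \kappa_s=\max_i\Big(1+\sum_{j=1}^m \frac{L_{ij}}{\tilde\sigma}\Big),\quad \alpha=\frac{2K}{\tilde\sigma\kappa_s},\quad p_{\rm comp}=\Big(1+\frac{\kappa_s}{m-1+\kappa_s}\Big)^{-1},\quad p_{\rm comm}=1-p_{\rm comp},$$ $$\pi_{ij}=\frac{1+L_{ij}/\tilde\sigma}{\sum_{j'}(1+L_{ij'}/\tilde\sigma)},\quad \eta=\min\Big(\frac{\tilde\sigma p_{\rm comm}}{2nK},\frac{p_{\rm comp}}{\alpha n(m-1+\kappa_s)}\Big),\quad \rho_{\rm comm}=\frac{nK\eta}{p_{\rm comm}\tilde\sigma},\quad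 \rho_{ij}=\frac{n\alpha\eta}{p_{\rm comp}\pi_{ij}}.$$ The TVR algorithm on the complete graph starts from arbitrary $z_0^{(ij)}\in\mathbb R^d$, $\theta_0^{(i)}=-\tilde\sigma^{-1}\sum_j\nabla f_{ij}(z_0^{(ij)})$ and $\theta_0^{{\rm token},k}=0$. At each step $t$, independently of the past: * with probability $p_{\rm comm}$ it draws $i\in[n]$ and $k\in[K]$ uniformly (token $k$ jumps to node $i$) and sets $\theta_{t+1}^{{\rm token},k}=\theta_t^{{\rm token},k}-\rho_{\rm comm}(\theta_t^{{\rm token},k}-\theta_t^{(i)})$ and $\theta_{t+1}^{(i)}=\theta_t^{(i)}+\rho_{\rm comm}(\theta_t^{{\rm token},k}-\theta_t^{(i)})$; * with probability $p_{\rm comp}$ it draws $i\in[n]$ uniformly and then $j\in[m]$ with probability $\pi_{ij}$ (a stochastic gradient step of node $i$), and sets $z_{t+1}^{(ij)}=(1-\rho_{ij})z_t^{(ij)}+\rho_{ij}\theta_t^{(i)}$ and $\theta_{t+1}^{(i)}=\theta_t^{(i)}-\tilde\sigma^{-1}\big(\nabla f_{ij}(z_{t+1}^{(ij)})-\nabla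 f_{ij}(z_t^{(ij)})\big)$. All other variables are unchanged. Let $\|\theta_t-\theta_\star\|^2=\sum_i\|\theta_t^{(i)}-\theta_\star\|^2+\sum_k\|\theta_t^{{\rm token},k}-\theta_\star\|^2$. Then there are an absolute constant $c>0$ and a constant $C_0\ge 1$, depending only on the problem, on $K$ and on $z_0$, such that for every $\varepsilon\in(0,1)$ there is a number of steps $T$ with $\mathbb E\|\theta_t-\theta_\star\|^2\le\varepsilon$ for all $t\ge T$ and $$T_{\rm comp}\le c\,(m+\kappa_s)\log\frac{C_0}{\varepsilon},\qquad T_{\rm comm}\le c\,\frac nK\,\kappa_s\log\frac{C_0}{\varepsilon},$$ where $T_{\rm comp}$ is the expected number of stochastic gradient steps performed by each node, and $T_{\rm comm}$ the expected number of jumps performed by each token, during the first $T$ steps. -/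

import Mathlib

open MeasureTheory ProbabilityTheory
open scoped NNReal

/-- Data of the decentralized finite-sum problem
`min_θ ∑ i, ((∑ j, f i j θ) + σ / 2 * ‖θ‖ ^ 2)` over `ℝ ^ d`, with `n` nodes and `m` component
functions per node; `L i j` is the smoothness parameter of `f i j`. -/
structure FiniteSumProblem (n m d : ℕ) where
  f : Fin n → Fin m → EuclideanSpace ℝ (Fin d) → ℝ
  L : Fin n → Fin m → ℝ≥0
  σ : ℝ

namespace FiniteSumProblem

variable {n m d : ℕ}

/-- Standing assumptions: positive regularization, and each `f i j` is convex and
`L i j`-smooth on the whole space. -/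
structure IsRegular (P : FiniteSumProblem n m d) : Prop where
  sigma_pos : 0 < P.σ
  convex : ∀ i j, ConvexOn ℝ Set.univ (P.f i j)
  differentiable : ∀ i j, Differentiable ℝ (P.f i j)
  smooth : ∀ i j, LipschitzWith (P.L i j) (gradient (P.f i j))

/-- The global objective. -/
noncomputable def objective (P : FiniteSumProblem n m d) (θ : EuclideanSpace ℝ (Fin d)) : ℝ :=
  ∑ i, ((∑ j, P.f i j θ) + P.σ / 2 * ‖θ‖ ^ 2)

/-- The regularization `σ̃ = n σ / (n + K)` carried by each node and each of the `K` tokens. -/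
noncomputable def sigmaTilde (P : FiniteSumProblem n m d) (K : ℕ) : ℝ :=
  n / (n + K) * P.σ

/-- The stochastic condition number `κ_s = max_i (1 + ∑ j, L i j / σ̃)`. -/
noncomputable def kappaS (P : FiniteSumProblem n m d) (K : ℕ) : ℝ :=
  ⨆ i, (1 + ∑ j, (P.L i j : ℝ) / P.sigmaTilde K)

/-- The weight parameter `α = 2 K / (σ̃ κ_s)` of the computation edges. -/
noncomputable def alpha (P : FiniteSumProblem n m d) (K : ℕ) : ℝ :=
  2 * K / (P.sigmaTilde K * P.kappaS K)

/-- Probability that a step is a computation step. -/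
noncomputable def pComp (P : FiniteSumProblem n m d) (K : ℕ) : ℝ :=
  (1 + P.kappaS K / ((m : ℝ) - 1 + P.kappaS K))⁻¹

/-- Probability that a step is a communication step. -/
noncomputable def pComm (P : FiniteSumProblem n m d) (K : ℕ) : ℝ :=
  1 - P.pComp K

/-- The step size `η`. -/
noncomputable def eta (P : FiniteSumProblem n m d) (K : ℕ) : ℝ :=
  min (P.sigmaTilde K * P.pComm K / (2 * n * K))
    (P.pComp K / (P.alpha K * n * ((m : ℝ) - 1 + P.kappaS K)))

/-- The communication step size. -/
noncomputable def rhoComm (P : FiniteSumProblem n m d) (K : ℕ) : ℝ :=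
  n * K * P.eta K / (P.pComm K * P.sigmaTilde K)

/-- Probability with which node `i`, when it computes, picks its component `j`; it is
proportional to `1 + L i j / σ̃` (hence uniform if all `L i j` of the node coincide). -/
noncomputable def componentProb (P : FiniteSumProblem n m d) (K : ℕ) (i : Fin n) (j : Fin m) : ℝ :=
  (1 + (P.L i j : ℝ) / P.sigmaTilde K) / ∑ j', (1 + (P.L i j' : ℝ) / P.sigmaTilde K)

/-- The computation step size, `n α η / (p_comp π_ij)` with `π_ij` the probability of picking `j`
at node `i` (hence `m n α η / p_comp` for uniform picks). -/
noncomputable def rhoComp (P : FiniteSumProblem n m d) (K : ℕ) (i : Fin n) (j : Fin m) : ℝ :=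
  n * P.alpha K * P.eta K / (P.pComp K * P.componentProb K i j)

end FiniteSumProblem

/-- One step of the token algorithm: `comm i k` means that token `k` jumps to node `i` and averages
with it; `comp i j` means that node `i` performs a stochastic gradient step on component `j`. -/
inductive TokenAction (n m K : ℕ) where
  | comm (i : Fin n) (k : Fin K) : TokenAction n m K
  | comp (i : Fin n) (j : Fin m) : TokenAction n m K
  deriving DecidableEq, Fintype

instance (n m K : ℕ) : MeasurableSpace (TokenAction n m K) := ⊤

/-- The variables of the algorithm: node parameters `node i`, token parameters `token k`, and
virtual parameters `z i j`. -/
structure TokenState (n m K d : ℕ) where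
  node : Fin n → EuclideanSpace ℝ (Fin d)
  token : Fin K → EuclideanSpace ℝ (Fin d)
  z : Fin n → Fin m → EuclideanSpace ℝ (Fin d)

/-- Squared distance of the stacked vector of all node and token parameters to the consensus
vector all of whose blocks equal `θ`. -/
noncomputable def TokenState.sqDist {n m K d : ℕ} (s : TokenState n m K d)
    (θ : EuclideanSpace ℝ (Fin d)) : ℝ :=
  (∑ i, ‖s.node i - θ‖ ^ 2) + ∑ k, ‖s.token k - θ‖ ^ 2

namespace FiniteSumProblem

variable {n m d : ℕ}

/-- Law of a single step of TVR: with probability `p_comm` a uniformly chosen token jumps to a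
uniformly chosen node (complete graph); with probability `p_comp` a uniformly chosen node picks
one of its components. -/
noncomputable def actionProb (P : FiniteSumProblem n m d) (K : ℕ) : TokenAction n m K → ℝ
  | .comm _ _ => P.pComm K / (n * K)
  | .comp i j => P.pComp K / n * P.componentProb K i j

/-- Initial state of TVR, from an arbitrary `z₀`. -/
noncomputable def tvrInit (P : FiniteSumProblem n m d) (K : ℕ)
    (z₀ : Fin n → Fin m → EuclideanSpace ℝ (Fin d)) : TokenState n m K d where
  node i := -((P.sigmaTilde K)⁻¹ • ∑ j, gradient (P.f i j) (z₀ i j))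
  token _ := 0
  z := z₀

/-- The TVR update. -/
noncomputable def tvrStep (P : FiniteSumProblem n m d) (K : ℕ) (s : TokenState n m K d) :
    TokenAction n m K → TokenState n m K d
  | .comm i k =>
    { node := Function.update s.node i
        (s.node i + P.rhoComm K • (s.token k - s.node i))
      token := Function.update s.token k
        (s.token k - P.rhoComm K • (s.token k - s.node i))
      z := s.z }
  | .comp i j =>
    let z' := (1 - P.rhoComp K i j) • s.z i j + P.rhoComp K i j • s.node i
    { node := Function.update s.node i
        (s.node i - (P.sigmaTilde K)⁻¹ •
          (gradient (P.f i j) z' - gradient (P.f i j) (s.z i j)))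
      token := s.token
      z := Function.update s.z i (Function.update (s.z i) j z') }

/-- State of TVR after `t` steps along the sequence of actions `a`. -/
noncomputable def tvr (P : FiniteSumProblem n m d) (K : ℕ)
    (z₀ : Fin n → Fin m → EuclideanSpace ℝ (Fin d)) (a : ℕ → TokenAction n m K) :
    ℕ → TokenState n m K d
  | 0 => P.tvrInit K z₀
  | t + 1 => P.tvrStep K (tvr P K z₀ a t) (a t)

end FiniteSumProblem

/-- The random actions `S 0, S 1, …` are independent, each with law `q`. -/
structure IsIIDActions {n m K : ℕ} {Ω : Type*} [MeasurableSpace Ω] (μ : Measure Ω)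
    (S : ℕ → Ω → TokenAction n m K) (q : TokenAction n m K → ℝ) : Prop where
  measurable : ∀ t, Measurable (S t)
  indep : iIndepFun S μ
  law : ∀ t a, μ.real (S t ⁻¹' {a}) = q a

/-- Number of stochastic gradient steps performed by node `i` during the first `T` steps. -/
def gradientSteps {n m K : ℕ} (a : ℕ → TokenAction n m K) (i : Fin n) (T : ℕ) : ℕ :=
  ((Finset.range T).filter fun t => ∃ j, a t = .comp i j).card

/-- Number of jumps performed by token `k` during the first `T` steps. -/
def tokenJumps {n m K : ℕ} (a : ℕ → TokenAction n m K) (k : Fin K) (T : ℕ) : ℕ :=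
  ((Finset.range T).filter fun t => ∃ i, a t = .comm i k).card

/-!
The algorithm is a randomized block coordinate descent on the dual of the consensus problem in
which every node and every token carries the regularization `σ̃`. The blocks are the edges of the
complete bipartite graph between nodes and tokens (jumps) and the pairs `(i, j)` (gradient steps,
taken in the mirror geometry of the conjugate of `f i j`, so that only gradients of `f i j` at the
virtual parameters `z i j` occur). The proof is a Lyapunov argument that never mentions conjugates:
divergences of conjugates are Bregman divergences of the `f i j` with exchanged arguments.

With `e` the vector of all `θ_v - θ_⋆`, let `V` be the dual suboptimality, that is `σ̃ / 2 ‖e‖²`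
plus the divergences `D (θ_⋆ | z i j)` (`dualGap`), and let `N` be the distance to the dual optimum
in the mirror geometry: the divergences `D (z i j | θ_⋆)` (`primalGap`) plus `α / 2` times the
quadratic form of the pseudo-inverse of the bipartite Laplacian (`bipartiteForm`), evaluated at the
flow `(x, y)` of residuals. The flow has sum zero at all times (`Balanced`): initially because of
the choice of `θ₀` and the optimality of `θ_⋆`, and afterwards because every action preserves it.
The Lyapunov function is `N + 2 V`.

* Each action changes `N + 2 V` by at most a first-order term, the `drift`: the second-order part
  of the change of `N` is absorbed by the decrease of `2 V` (`lyapunov_comm_le`,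
  `lyapunov_comp_le`). For gradient steps this uses the cocoercivity of `∇ (f i j)` and the bound
  `ρ_ij (1 + L_ij / σ̃) ≤ 1`; for jumps it uses `ρ_comm = 1 / 2`.
* The step sizes are proportional to the inverse probabilities, so the expected drift is `-α η`
  times the sum of `σ̃ ‖e‖²` and of both families of divergences, the terms that couple nodes and
  virtual parameters having cancelled (`sum_actionProb_mul_drift`).
* The choice of `α` makes the quadratic part of `N` at most `σ̃ ‖e‖²` plus twice the `primalGap`
  (`alpha_mul_bipartiteForm_le`), so one step contracts the expectation of `N + 2 V` by the factor
  `1 - α η / 3` (`sum_actionProb_mul_lyapunov_le`).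

The two terms in the definition of `η` coincide and `α η = 1 / (n (m - 1 + 2 κ_s))`. Hence
`T ≈ 3 n (m - 1 + 2 κ_s) log (C₀ / ε)` steps suffice, of which each node computes the fraction
`p_comp / n` and each token jumps the fraction `p_comm / K` on average.
-/

/-! ### Bregman divergences of smooth convex functions -/

section Bregman

variable {F : Type*} [NormedAddCommGroup F] [InnerProductSpace ℝ F] [CompleteSpace F]

/-- The Bregman divergence `f x - f y - ⟪∇f y, x - y⟫` of `f` at `x` relative to `y`. -/
noncomputable def bregman (f : F → ℝ) (x y : F) : ℝ :=
  f x - f y - inner ℝ (gradient f y) (x - y)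

lemma bregman_add_bregman_swap (f : F → ℝ) (x y : F) :
    bregman f x y + bregman f y x = inner ℝ (gradient f x - gradient f y) (x - y) := by
  simp only [bregman, inner_sub_left, inner_sub_right]
  ring

/-- Three-point identity in the first argument. -/
lemma bregman_sub_bregman_right (f : F → ℝ) (u v w : F) :
    bregman f v w - bregman f u w =
      bregman f v u + inner ℝ (gradient f u - gradient f w) (v - u) := by
  simp only [bregman, inner_sub_left, inner_sub_right]
  ring

/-- Three-point identity in the second argument. -/
lemma bregman_sub_bregman_left (f : F → ℝ) (u v w : F) :
    bregman f w v - bregman f w u =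
      bregman f u v + inner ℝ (gradient f v - gradient f u) (u - w) := by
  simp only [bregman, inner_sub_left, inner_sub_right]
  ring

lemma hasDerivAt_comp_line {f : F → ℝ} (hf : Differentiable ℝ f) (x v : F) (t : ℝ) :
    HasDerivAt (fun s : ℝ => f (x + s • v)) (inner ℝ (gradient f (x + t • v)) v) t := by
  have h1 : HasDerivAt (fun s : ℝ => x + s • v) v t := by
    simpa using ((hasDerivAt_id t).smul_const v).const_add x
  have h2 := (hf (x + t • v)).hasFDerivAt.comp_hasDerivAt t h1
  rwa [← inner_gradient_left] at h2

lemma bregman_nonneg {f : F → ℝ} (hf : Differentiable ℝ f) (hc : ConvexOn ℝ Set.univ f)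
    (x y : F) : 0 ≤ bregman f x y := by
  have hd := hasDerivAt_comp_line hf y (x - y) 0
  have hcl : ConvexOn ℝ Set.univ (fun s : ℝ => f (y + s • (x - y))) := by
    have heq : (fun s : ℝ => f (y + s • (x - y))) = f ∘ (AffineMap.lineMap y x : ℝ →ᵃ[ℝ] F) := by
      funext s
      simp [AffineMap.lineMap_apply, add_comm]
    rw [heq]
    exact hc.comp_affineMap (AffineMap.lineMap y x : ℝ →ᵃ[ℝ] F)
  have := hcl.le_slope_of_hasDerivAt (Set.mem_univ 0) (Set.mem_univ 1) zero_lt_one hd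
  simp only [slope_def_field, zero_smul, add_zero, one_smul, add_sub_cancel, sub_zero,
    div_one] at this
  rw [bregman]
  linarith

/-- The descent lemma. -/
lemma bregman_le_of_lipschitzWith_gradient {f : F → ℝ} {L : ℝ≥0} (hf : Differentiable ℝ f)
    (hL : LipschitzWith L (gradient f)) (x y : F) :
    bregman f x y ≤ L / 2 * ‖x - y‖ ^ 2 := by
  have hd (t : ℝ) : HasDerivAt
      (fun s : ℝ => f (y + s • (x - y)) - s * inner ℝ (gradient f y) (x - y)
        - L / 2 * ‖x - y‖ ^ 2 * s ^ 2)
      (inner ℝ (gradient f (y + t • (x - y))) (x - y) - inner ℝ (gradient f y) (x - y)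
        - L * ‖x - y‖ ^ 2 * t) t := by
    have h1 := hasDerivAt_comp_line hf y (x - y) t
    have h2 := (hasDerivAt_id t).mul_const (inner ℝ (gradient f y) (x - y))
    have h3 := ((hasDerivAt_id t).pow 2).const_mul (L / 2 * ‖x - y‖ ^ 2)
    refine ((h1.sub h2).sub h3).congr_deriv ?_
    simp only [id, one_mul, Nat.cast_ofNat]
    ring
  have hanti := antitoneOn_of_deriv_nonpos (convex_Ici (0 : ℝ))
    (fun t _ => (hd t).continuousAt.continuousWithinAt)
    (fun t _ => (hd t).differentiableAt.differentiableWithinAt)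
    (fun t ht => by
      rw [(hd t).deriv]
      have ht : 0 < t := by simpa using ht
      have h1 := real_inner_le_norm (gradient f (y + t • (x - y)) - gradient f y) (x - y)
      have h2 := hL.dist_le_mul (y + t • (x - y)) y
      rw [dist_eq_norm, dist_eq_norm, add_sub_cancel_left, norm_smul, Real.norm_of_nonneg ht.le]
        at h2
      rw [inner_sub_left] at h1
      nlinarith [norm_nonneg (x - y)])
  have := hanti (Set.mem_Ici.2 le_rfl) (Set.mem_Ici.2 zero_le_one) zero_le_one
  simp only [one_smul, add_sub_cancel, zero_smul, add_zero] at this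
  rw [bregman]
  linarith

/-- Cocoercivity of the gradient. It comes from the nonnegativity of the Bregman divergence
relative to `y` at the point reached from `x` by a gradient step of length `1 / L`. -/
lemma norm_gradient_sub_sq_le {f : F → ℝ} {L : ℝ≥0} (hf : Differentiable ℝ f)
    (hc : ConvexOn ℝ Set.univ f) (hL : LipschitzWith L (gradient f)) (x y : F) :
    ‖gradient f x - gradient f y‖ ^ 2 ≤ 2 * L * bregman f x y := by
  rcases eq_or_ne L 0 with rfl | h0
  · have := hL.dist_le_mul x y
    rw [dist_eq_norm] at this
    have h : ‖gradient f x - gradient f y‖ = 0 := le_antisymm (by simpa using this) (norm_nonneg _)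
    simp [h]
  · have hpos : (0 : ℝ) < L := by exact_mod_cast pos_iff_ne_zero.2 h0
    set g := gradient f x - gradient f y with hg
    set u := x - (L : ℝ)⁻¹ • g with hu
    have h1 := bregman_nonneg hf hc u y
    have h2 := bregman_le_of_lipschitzWith_gradient hf hL u x
    have h3 := bregman_sub_bregman_right f x u y
    have hux : u - x = -((L : ℝ)⁻¹ • g) := by rw [hu]; abel
    rw [hux, norm_neg, norm_smul, Real.norm_of_nonneg (inv_nonneg.2 hpos.le), mul_pow] at h2
    rw [hux, ← hg, inner_neg_right, real_inner_smul_right, real_inner_self_eq_norm_sq] at h3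
    have h4 : (L : ℝ) / 2 * ((L : ℝ)⁻¹ ^ 2 * ‖g‖ ^ 2) = (L : ℝ)⁻¹ * ‖g‖ ^ 2 / 2 := by
      field_simp
    have h5 : (L : ℝ)⁻¹ * ‖g‖ ^ 2 ≤ 2 * bregman f x y := by linarith
    rw [inv_mul_le_iff₀ hpos] at h5
    linarith

end Bregman

/-! ### Sums -/

lemma Finset.sum_apply_update {ι M : Type*} [Fintype ι] [DecidableEq ι] [AddCommGroup M]
    {X : ι → Type*} (F : ∀ i, X i → M) (g : ∀ i, X i) (i : ι) (v : X i) :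
    ∑ j, F j (Function.update g i v j) = ∑ j, F j (g j) + (F i v - F i (g i)) := by
  rw [← sub_eq_iff_eq_add', ← Finset.sum_sub_distrib, Finset.sum_eq_single i]
  · simp
  · intro j _ hj
    simp [Function.update_of_ne hj]
  · simp

lemma TokenAction.sum_eq {n m K : ℕ} {M : Type*} [AddCommMonoid M] (g : TokenAction n m K → M) :
    ∑ a, g a = ∑ i, ∑ k, g (.comm i k) + ∑ i, ∑ j, g (.comp i j) := by
  let e : (Fin n × Fin K) ⊕ (Fin n × Fin m) ≃ TokenAction n m K :=
    { toFun := Sum.elim (fun p => .comm p.1 p.2) (fun p => .comp p.1 p.2)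
      invFun := fun a => match a with
        | .comm i k => .inl (i, k)
        | .comp i j => .inr (i, j)
      left_inv := by rintro (⟨i, k⟩ | ⟨i, j⟩) <;> rfl
      right_inv := by rintro (⟨i, k⟩ | ⟨i, j⟩) <;> rfl }
  rw [← e.sum_comp, Fintype.sum_sum_type, Fintype.sum_prod_type, Fintype.sum_prod_type]
  rfl

/-- Cauchy–Schwarz for a sum with one distinguished term; the weights `w j` may vanish. -/
lemma norm_smul_add_sum_sq_le {ι F : Type*} [Fintype ι] [NormedAddCommGroup F] [NormedSpace ℝ F]
    {c : ℝ} (hc : 0 ≤ c) (e : F) (v : ι → F) (w b : ι → ℝ) (hw : ∀ j, 0 ≤ w j)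
    (hb : ∀ j, 0 ≤ b j) (h : ∀ j, ‖v j‖ ^ 2 ≤ w j * b j) :
    ‖c • e + ∑ j, v j‖ ^ 2 ≤ (c + ∑ j, w j) * (c * ‖e‖ ^ 2 + ∑ j, b j) := by
  have h1 : (∑ j, ‖v j‖) ^ 2 ≤ (∑ j, w j) * ∑ j, b j := by
    refine (Finset.sum_sq_le_sum_mul_sum_of_sq_le_mul _ (fun j _ => hw j) (fun j _ => hb j) ?_)
    exact fun j _ => h j
  have h2 : ‖c • e + ∑ j, v j‖ ≤ c * ‖e‖ + ∑ j, ‖v j‖ := by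
    refine (norm_add_le _ _).trans (add_le_add ?_ (norm_sum_le _ _))
    rw [norm_smul, Real.norm_of_nonneg hc]
  have hW : 0 ≤ ∑ j, w j := Finset.sum_nonneg fun j _ => hw j
  have hB : 0 ≤ ∑ j, b j := Finset.sum_nonneg fun j _ => hb j
  have hV : 0 ≤ ∑ j, ‖v j‖ := Finset.sum_nonneg fun j _ => norm_nonneg _
  set W := ∑ j, w j
  set B := ∑ j, b j
  set V := ∑ j, ‖v j‖
  have hx := norm_nonneg e
  set x := ‖e‖
  have h3 : 2 * (x * V) ≤ W * x ^ 2 + B := by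
    refine le_of_sq_le_sq ?_ (by positivity)
    nlinarith [mul_le_mul_of_nonneg_left h1 (sq_nonneg x), sq_nonneg (W * x ^ 2 - B)]
  calc ‖c • e + ∑ j, v j‖ ^ 2 ≤ (c * x + V) ^ 2 := by gcongr
    _ ≤ _ := by nlinarith [mul_le_mul_of_nonneg_left h3 hc]

/-! ### The communication quadratic form of the complete bipartite graph -/

section BipartiteForm

variable {n K : ℕ} {F : Type*} [NormedAddCommGroup F]

/-- The quadratic form of the pseudo-inverse of the Laplacian of the complete bipartite graph
between `n` nodes and `K` tokens, in the closed form that it takes at vectors `(x, y)` of total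
sum zero. -/
noncomputable def bipartiteForm (x : Fin n → F) (y : Fin K → F) : ℝ :=
  (∑ k, ‖y k‖ ^ 2) / n + (∑ i, ‖x i‖ ^ 2) / K - ‖∑ k, y k‖ ^ 2 / (n * K)

lemma bipartiteForm_nonneg (x : Fin n → F) (y : Fin K → F) : 0 ≤ bipartiteForm x y := by
  have h1 : ‖∑ k, y k‖ ^ 2 ≤ K * ∑ k, ‖y k‖ ^ 2 := by
    have h := sq_sum_le_card_mul_sum_sq (s := Finset.univ) (f := fun k => ‖y k‖)
    rw [Finset.card_univ, Fintype.card_fin] at h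
    exact (pow_le_pow_left₀ (norm_nonneg _) (norm_sum_le _ _) 2).trans h
  have h2 : ‖∑ k, y k‖ ^ 2 / (n * K) ≤ (∑ k, ‖y k‖ ^ 2) / n := by
    rcases Nat.eq_zero_or_pos K with rfl | hK
    · simp
    rcases Nat.eq_zero_or_pos n with rfl | hn
    · simp
    have hK' : (0 : ℝ) < K := by exact_mod_cast hK
    have hn' : (0 : ℝ) < n := by exact_mod_cast hn
    rw [div_le_div_iff₀ (by positivity) hn']
    nlinarith
  have h3 : 0 ≤ (∑ i, ‖x i‖ ^ 2) / (K : ℝ) := by positivity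
  rw [bipartiteForm]
  linarith

lemma bipartiteForm_le (hK : 1 ≤ K) (hKn : K ≤ n) (x : Fin n → F) (y : Fin K → F) :
    bipartiteForm x y ≤ ((∑ i, ‖x i‖ ^ 2) + ∑ k, ‖y k‖ ^ 2) / K := by
  have hK' : (0 : ℝ) < K := by exact_mod_cast hK
  have hKn' : (K : ℝ) ≤ n := by exact_mod_cast hKn
  have h1 : (∑ k, ‖y k‖ ^ 2) / (n : ℝ) ≤ (∑ k, ‖y k‖ ^ 2) / K := by gcongr
  have h2 : 0 ≤ ‖∑ k, y k‖ ^ 2 / ((n : ℝ) * K) := by positivity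
  rw [bipartiteForm, add_div]
  linarith

variable [InnerProductSpace ℝ F]

/-- Change of the form when a vector `v` moves along the edge from node `i` to token `k`. -/
lemma bipartiteForm_update (x : Fin n → F) (y : Fin K → F) (i : Fin n) (k : Fin K) (v : F) :
    bipartiteForm (Function.update x i (x i - v)) (Function.update y k (y k + v)) =
      bipartiteForm x y
        + 2 * inner ℝ v ((n : ℝ)⁻¹ • y k - (K : ℝ)⁻¹ • x i - ((n : ℝ) * K)⁻¹ • ∑ k', y k')
        + ‖v‖ ^ 2 * ((n : ℝ)⁻¹ + (K : ℝ)⁻¹ - ((n : ℝ) * K)⁻¹) := by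
  rw [bipartiteForm, bipartiteForm, Finset.sum_apply_update (fun _ u => ‖u‖ ^ 2),
    Finset.sum_apply_update (fun _ u => ‖u‖ ^ 2), Finset.sum_apply_update (fun _ u => u)]
  simp only [add_sub_cancel_left, norm_add_sq_real, norm_sub_sq_real, inner_sub_right,
    real_inner_smul_right, real_inner_comm v]
  ring

/-- Summed over all edges, the first-order terms of the form recover the inner product: this is
the identity `L L† = 1` for the bipartite Laplacian on vectors of total sum zero. -/
lemma sum_inner_bipartite (hn : n ≠ 0) (hK : K ≠ 0) (x e : Fin n → F) (y w : Fin K → F)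
    (hsum : ∑ i, x i + ∑ k, y k = 0) :
    ∑ i, ∑ k, inner ℝ (e i - w k)
      ((n : ℝ)⁻¹ • y k - (K : ℝ)⁻¹ • x i - ((n : ℝ) * K)⁻¹ • ∑ k', y k') =
      -(∑ i, inner ℝ (e i) (x i) + ∑ k, inner ℝ (w k) (y k)) := by
  have hn' : (n : ℝ) ≠ 0 := by exact_mod_cast hn
  have hK' : (K : ℝ) ≠ 0 := by exact_mod_cast hK
  have hx : ∑ i, x i = -∑ k, y k := eq_neg_of_add_eq_zero_left hsum
  have h1 (i : Fin n) : ∑ k, inner ℝ (e i)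
      ((n : ℝ)⁻¹ • y k - (K : ℝ)⁻¹ • x i - ((n : ℝ) * K)⁻¹ • ∑ k', y k') =
      -inner ℝ (e i) (x i) := by
    rw [← inner_sum, Finset.sum_sub_distrib, Finset.sum_sub_distrib, ← Finset.smul_sum]
    simp only [Finset.sum_const, Finset.card_univ, Fintype.card_fin, ← Nat.cast_smul_eq_nsmul ℝ,
      smul_smul, inner_sub_right, real_inner_smul_right]
    field_simp
    ring
  have h2 (k : Fin K) : ∑ i, inner ℝ (w k)
      ((n : ℝ)⁻¹ • y k - (K : ℝ)⁻¹ • x i - ((n : ℝ) * K)⁻¹ • ∑ k', y k') =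
      inner ℝ (w k) (y k) := by
    rw [← inner_sum, Finset.sum_sub_distrib, Finset.sum_sub_distrib,
      ← Finset.smul_sum (r := (K : ℝ)⁻¹) (f := x), hx]
    simp only [Finset.sum_const, Finset.card_univ, Fintype.card_fin, ← Nat.cast_smul_eq_nsmul ℝ,
      smul_smul, inner_sub_right, real_inner_smul_right, inner_neg_right]
    field_simp
    ring
  simp only [inner_sub_left, Finset.sum_sub_distrib]
  rw [Finset.sum_congr rfl fun i _ => h1 i, Finset.sum_comm (f := fun i k => inner ℝ (w k) _),
    Finset.sum_congr rfl fun k _ => h2 k, Finset.sum_neg_distrib]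
  ring

end BipartiteForm

/-! ### The parameters of the algorithm -/

namespace FiniteSumProblem

variable {n m d K : ℕ} {P : FiniteSumProblem n m d}

lemma sigmaTilde_pos (hn : 0 < n) (hσ : 0 < P.σ) : 0 < P.sigmaTilde K := by
  have : (0 : ℝ) < n := by exact_mod_cast hn
  unfold sigmaTilde
  positivity

lemma add_mul_sigmaTilde (hn : 0 < n) : ((n : ℝ) + K) * P.sigmaTilde K = n * P.σ := by
  have : (0 : ℝ) < n := by exact_mod_cast hn
  unfold sigmaTilde
  field_simp

lemma one_add_sum_le_kappaS (i : Fin n) :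
    1 + ∑ j, (P.L i j : ℝ) / P.sigmaTilde K ≤ P.kappaS K :=
  le_ciSup (f := fun i => 1 + ∑ j, (P.L i j : ℝ) / P.sigmaTilde K) (Set.finite_range _).bddAbove i

lemma sum_one_add_le (i : Fin n) :
    ∑ j, (1 + (P.L i j : ℝ) / P.sigmaTilde K) ≤ (m : ℝ) - 1 + P.kappaS K := by
  have := P.one_add_sum_le_kappaS (K := K) i
  simp only [Finset.sum_add_distrib, Finset.sum_const, Finset.card_univ, Fintype.card_fin,
    nsmul_eq_mul, mul_one]
  linarith

lemma one_add_div_pos (hn : 0 < n) (hσ : 0 < P.σ) (i : Fin n) (j : Fin m) :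
    0 < 1 + (P.L i j : ℝ) / P.sigmaTilde K := by
  have := P.sigmaTilde_pos (K := K) hn hσ
  positivity

lemma one_le_kappaS (hn : 0 < n) (hσ : 0 < P.σ) : 1 ≤ P.kappaS K := by
  have := P.sigmaTilde_pos (K := K) hn hσ
  refine le_trans ?_ (P.one_add_sum_le_kappaS (K := K) ⟨0, hn⟩)
  have : 0 ≤ ∑ j, (P.L ⟨0, hn⟩ j : ℝ) / P.sigmaTilde K :=
    Finset.sum_nonneg fun j _ => by positivity
  linarith

lemma pComp_eq (hn : 0 < n) (hm : 1 ≤ m) (hσ : 0 < P.σ) :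
    P.pComp K = ((m : ℝ) - 1 + P.kappaS K) / ((m : ℝ) - 1 + 2 * P.kappaS K) := by
  have h1 := P.one_le_kappaS (K := K) hn hσ
  have h2 : (1 : ℝ) ≤ m := by exact_mod_cast hm
  have h3 : (m : ℝ) - 1 + P.kappaS K ≠ 0 := by linarith
  rw [pComp, one_add_div h3, inv_div]
  ring

lemma pComm_eq (hn : 0 < n) (hm : 1 ≤ m) (hσ : 0 < P.σ) :
    P.pComm K = P.kappaS K / ((m : ℝ) - 1 + 2 * P.kappaS K) := by
  have h1 := P.one_le_kappaS (K := K) hn hσ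
  have h2 : (1 : ℝ) ≤ m := by exact_mod_cast hm
  have h3 : (m : ℝ) - 1 + 2 * P.kappaS K ≠ 0 := by linarith
  rw [pComm, P.pComp_eq hn hm hσ, one_sub_div h3]
  ring

/-- The two terms of the minimum that defines `η` coincide. -/
lemma eta_eq (hn : 0 < n) (hm : 1 ≤ m) (hK : 0 < K) (hσ : 0 < P.σ) :
    P.eta K = P.sigmaTilde K * P.kappaS K / (2 * n * K * ((m : ℝ) - 1 + 2 * P.kappaS K)) := by
  have h1 := P.one_le_kappaS (K := K) hn hσ
  have h2 : (1 : ℝ) ≤ m := by exact_mod_cast hm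
  have hn' : (0 : ℝ) < n := by exact_mod_cast hn
  have hK' : (0 : ℝ) < K := by exact_mod_cast hK
  have hs := P.sigmaTilde_pos (K := K) hn hσ
  have h3 : 0 < (m : ℝ) - 1 + 2 * P.kappaS K := by linarith
  have h4 : 0 < (m : ℝ) - 1 + P.kappaS K := by linarith
  rw [eta, P.pComp_eq hn hm hσ, P.pComm_eq hn hm hσ, alpha]
  generalize (m : ℝ) - 1 + 2 * P.kappaS K = b at *
  generalize (m : ℝ) - 1 + P.kappaS K = a at *
  have : P.sigmaTilde K * (P.kappaS K / b) / (2 * n * K) =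
      a / b / (2 * K / (P.sigmaTilde K * P.kappaS K) * n * a) := by
    field_simp
  rw [← this, min_self]
  field_simp

lemma alpha_mul_eta (hn : 0 < n) (hm : 1 ≤ m) (hK : 0 < K) (hσ : 0 < P.σ) :
    P.alpha K * P.eta K = (n * ((m : ℝ) - 1 + 2 * P.kappaS K))⁻¹ := by
  have h1 := P.one_le_kappaS (K := K) hn hσ
  have h2 : (1 : ℝ) ≤ m := by exact_mod_cast hm
  have hn' : (0 : ℝ) < n := by exact_mod_cast hn
  have hK' : (0 : ℝ) < K := by exact_mod_cast hK
  have hs := P.sigmaTilde_pos (K := K) hn hσ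
  have h3 : 0 < (m : ℝ) - 1 + 2 * P.kappaS K := by linarith
  rw [P.eta_eq hn hm hK hσ, alpha]
  field_simp

lemma rhoComm_eq (hn : 0 < n) (hm : 1 ≤ m) (hK : 0 < K) (hσ : 0 < P.σ) :
    P.rhoComm K = 1 / 2 := by
  have h1 := P.one_le_kappaS (K := K) hn hσ
  have h2 : (1 : ℝ) ≤ m := by exact_mod_cast hm
  have hn' : (0 : ℝ) < n := by exact_mod_cast hn
  have hK' : (0 : ℝ) < K := by exact_mod_cast hK
  have hs := P.sigmaTilde_pos (K := K) hn hσ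
  have h3 : 0 < (m : ℝ) - 1 + 2 * P.kappaS K := by linarith
  rw [rhoComm, P.eta_eq hn hm hK hσ, P.pComm_eq hn hm hσ]
  generalize (m : ℝ) - 1 + 2 * P.kappaS K = b at *
  field_simp

lemma componentProb_pos (hn : 0 < n) (hσ : 0 < P.σ) (i : Fin n) (j : Fin m) :
    0 < P.componentProb K i j :=
  div_pos (P.one_add_div_pos hn hσ i j)
    (Finset.sum_pos (fun j' _ => P.one_add_div_pos hn hσ i j') ⟨j, Finset.mem_univ _⟩)

lemma sum_componentProb (hn : 0 < n) (hm : 1 ≤ m) (hσ : 0 < P.σ) (i : Fin n) :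
    ∑ j, P.componentProb K i j = 1 := by
  have : 0 < ∑ j', (1 + (P.L i j' : ℝ) / P.sigmaTilde K) :=
    Finset.sum_pos (fun j' _ => P.one_add_div_pos hn hσ i j') ⟨⟨0, hm⟩, Finset.mem_univ _⟩
  simp only [componentProb, ← Finset.sum_div]
  exact div_self this.ne'

lemma pComp_pos (hn : 0 < n) (hm : 1 ≤ m) (hσ : 0 < P.σ) : 0 < P.pComp K := by
  have h1 := P.one_le_kappaS (K := K) hn hσ
  have h2 : (1 : ℝ) ≤ m := by exact_mod_cast hm
  rw [P.pComp_eq hn hm hσ]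
  apply div_pos <;> linarith

lemma pComm_pos (hn : 0 < n) (hm : 1 ≤ m) (hσ : 0 < P.σ) : 0 < P.pComm K := by
  have h1 := P.one_le_kappaS (K := K) hn hσ
  have h2 : (1 : ℝ) ≤ m := by exact_mod_cast hm
  rw [P.pComm_eq hn hm hσ]
  apply div_pos <;> linarith

lemma rhoComp_pos (hn : 0 < n) (hm : 1 ≤ m) (hK : 0 < K) (hσ : 0 < P.σ) (i : Fin n)
    (j : Fin m) : 0 < P.rhoComp K i j := by
  have h1 := P.one_le_kappaS (K := K) hn hσ
  have h2 : (1 : ℝ) ≤ m := by exact_mod_cast hm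
  have hn' : (0 : ℝ) < n := by exact_mod_cast hn
  have h3 : 0 < (m : ℝ) - 1 + 2 * P.kappaS K := by linarith
  have h4 := P.pComp_pos (K := K) hn hm hσ
  have h5 := P.componentProb_pos (K := K) hn hσ i j
  rw [rhoComp, mul_assoc, P.alpha_mul_eta hn hm hK hσ]
  positivity

/-- The step size along a component is at most the inverse of the relative smoothness constant
`1 + L i j / σ̃` of the dual objective along that component. -/
lemma rhoComp_mul_le (hn : 0 < n) (hm : 1 ≤ m) (hK : 0 < K) (hσ : 0 < P.σ) (i : Fin n)
    (j : Fin m) : P.rhoComp K i j * (1 + P.L i j / P.sigmaTilde K) ≤ 1 := by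
  have h1 := P.one_le_kappaS (K := K) hn hσ
  have h2 : (1 : ℝ) ≤ m := by exact_mod_cast hm
  have hn' : (0 : ℝ) < n := by exact_mod_cast hn
  have h3 : 0 < (m : ℝ) - 1 + 2 * P.kappaS K := by linarith
  have h4 : 0 < (m : ℝ) - 1 + P.kappaS K := by linarith
  have h5 := P.one_add_div_pos (K := K) hn hσ i j
  have h6 := P.sum_one_add_le (K := K) i
  have h7 : 0 < ∑ j', (1 + (P.L i j' : ℝ) / P.sigmaTilde K) :=
    Finset.sum_pos (fun j' _ => P.one_add_div_pos hn hσ i j') ⟨j, Finset.mem_univ _⟩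
  rw [rhoComp, mul_assoc, P.alpha_mul_eta hn hm hK hσ, P.pComp_eq hn hm hσ, componentProb]
  generalize ∑ j', (1 + (P.L i j' : ℝ) / P.sigmaTilde K) = S at *
  generalize (1 + (P.L i j : ℝ) / P.sigmaTilde K) = l at *
  generalize (m : ℝ) - 1 + 2 * P.kappaS K = b at *
  generalize (m : ℝ) - 1 + P.kappaS K = a at *
  have : n * (n * b)⁻¹ / (a / b * (l / S)) * l = S / a := by field_simp
  rw [this, div_le_one h4]
  exact h6

lemma actionProb_nonneg (hn : 0 < n) (hm : 1 ≤ m) (hσ : 0 < P.σ) (a : TokenAction n m K) :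
    0 ≤ P.actionProb K a := by
  cases a with
  | comm i k => exact div_nonneg (P.pComm_pos hn hm hσ).le (by positivity)
  | comp i j =>
    exact mul_nonneg (div_nonneg (P.pComp_pos hn hm hσ).le (by positivity))
      (P.componentProb_pos hn hσ i j).le

lemma sum_actionProb (hn : 0 < n) (hm : 1 ≤ m) (hK : 0 < K) (hσ : 0 < P.σ) :
    ∑ a, P.actionProb K a = 1 := by
  have hn' : (0 : ℝ) < n := by exact_mod_cast hn
  have hK' : (0 : ℝ) < K := by exact_mod_cast hK
  rw [TokenAction.sum_eq]
  simp only [actionProb, ← Finset.mul_sum, P.sum_componentProb hn hm hσ, Finset.sum_const,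
    Finset.card_univ, Fintype.card_fin, nsmul_eq_mul, pComm]
  field_simp
  ring

end FiniteSumProblem

/-! ### The Lyapunov function -/

namespace FiniteSumProblem

variable {n m d : ℕ} (P : FiniteSumProblem n m d) (K : ℕ) (θ : EuclideanSpace ℝ (Fin d))

/-- Communication part of the dual variable of node `i`, relative to its value at the optimum. -/
noncomputable def nodeResidual (s : TokenState n m K d) (i : Fin n) : EuclideanSpace ℝ (Fin d) :=
  P.sigmaTilde K • (s.node i - θ) +
    ∑ j, (gradient (P.f i j) (s.z i j) - gradient (P.f i j) θ)

/-- Communication part of the dual variable of token `k`, relative to its value at the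
optimum. -/
noncomputable def tokenResidual (s : TokenState n m K d) (k : Fin K) :
    EuclideanSpace ℝ (Fin d) :=
  P.sigmaTilde K • (s.token k - θ)

/-- The residuals are a flow on the edges of the complete bipartite graph: they sum to zero. -/
def Balanced (s : TokenState n m K d) : Prop :=
  ∑ i, P.nodeResidual K θ s i + ∑ k, P.tokenResidual K θ s k = 0

/-- The suboptimality of `s` for the dual problem when `θ` is the optimum. A Bregman divergence of
the conjugate of `f` at `∇f z` relative to `∇f θ` equals the one of `f` at `θ` relative to `z`, in
which form it appears here. -/
noncomputable def dualGap (s : TokenState n m K d) : ℝ :=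
  P.sigmaTilde K / 2 * s.sqDist θ + ∑ i, ∑ j, bregman (P.f i j) θ (s.z i j)

/-- The sum of the Bregman divergences at the virtual parameters relative to `θ`. -/
noncomputable def primalGap (s : TokenState n m K d) : ℝ :=
  ∑ i, ∑ j, bregman (P.f i j) (s.z i j) θ

/-- The Lyapunov function: the distance to the optimum in the mirror geometry of the dual
coordinate descent, plus twice the dual suboptimality. -/
noncomputable def lyapunov (s : TokenState n m K d) : ℝ :=
  P.alpha K / 2 * bipartiteForm (P.nodeResidual K θ s) (P.tokenResidual K θ s)
    + P.primalGap K θ s + 2 * P.dualGap K θ s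

/-- The first-order part of the change of the Lyapunov function under an action. -/
noncomputable def drift (s : TokenState n m K d) : TokenAction n m K → ℝ
  | .comm i k => P.alpha K * P.rhoComm K * P.sigmaTilde K *
      inner ℝ ((s.node i - θ) - (s.token k - θ))
        ((n : ℝ)⁻¹ • P.tokenResidual K θ s k - (K : ℝ)⁻¹ • P.nodeResidual K θ s i
          - ((n : ℝ) * K)⁻¹ • ∑ k', P.tokenResidual K θ s k')
  | .comp i j => -(P.rhoComp K i j *
      inner ℝ (gradient (P.f i j) (s.z i j) - gradient (P.f i j) θ) (s.z i j - s.node i))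

variable {P K θ}

lemma nodeResidual_comm (s : TokenState n m K d) (i : Fin n) (k : Fin K) :
    P.nodeResidual K θ (P.tvrStep K s (.comm i k)) =
      Function.update (P.nodeResidual K θ s) i (P.nodeResidual K θ s i -
        (P.rhoComm K * P.sigmaTilde K) • ((s.node i - θ) - (s.token k - θ))) := by
  funext i'
  rcases eq_or_ne i' i with rfl | h
  · simp only [nodeResidual, tvrStep, Function.update_self]
    module
  · simp only [nodeResidual, tvrStep, Function.update_of_ne h]

lemma tokenResidual_comm (s : TokenState n m K d) (i : Fin n) (k : Fin K) :
    P.tokenResidual K θ (P.tvrStep K s (.comm i k)) =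
      Function.update (P.tokenResidual K θ s) k (P.tokenResidual K θ s k +
        (P.rhoComm K * P.sigmaTilde K) • ((s.node i - θ) - (s.token k - θ))) := by
  funext k'
  rcases eq_or_ne k' k with rfl | h
  · simp only [tokenResidual, tvrStep, Function.update_self]
    module
  · simp only [tokenResidual, tvrStep, Function.update_of_ne h]

lemma nodeResidual_comp (hs : P.sigmaTilde K ≠ 0) (s : TokenState n m K d) (i : Fin n)
    (j : Fin m) :
    P.nodeResidual K θ (P.tvrStep K s (.comp i j)) = P.nodeResidual K θ s := by
  funext i'
  rcases eq_or_ne i' i with rfl | h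
  · simp only [nodeResidual, tvrStep, Function.update_self]
    rw [Finset.sum_apply_update
      (fun j u => gradient (P.f i' j) u - gradient (P.f i' j) θ)]
    simp only [smul_sub, smul_inv_smul₀ hs]
    abel
  · simp only [nodeResidual, tvrStep, Function.update_of_ne h]

lemma tokenResidual_comp (s : TokenState n m K d) (i : Fin n) (j : Fin m) :
    P.tokenResidual K θ (P.tvrStep K s (.comp i j)) = P.tokenResidual K θ s := rfl

lemma Balanced.tvrStep (hs : P.sigmaTilde K ≠ 0) {s : TokenState n m K d}
    (h : P.Balanced K θ s) (a : TokenAction n m K) : P.Balanced K θ (P.tvrStep K s a) := by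
  cases a with
  | comm i k =>
    unfold Balanced at h ⊢
    rw [nodeResidual_comm, tokenResidual_comm, Finset.sum_apply_update (fun _ u => u),
      Finset.sum_apply_update (fun _ u => u), ← h]
    abel
  | comp i j =>
    unfold Balanced at h ⊢
    rw [nodeResidual_comp hs, tokenResidual_comp, h]

/-! ### One step of the algorithm -/

lemma dualGap_comm (s : TokenState n m K d) (i : Fin n) (k : Fin K) :
    P.dualGap K θ (P.tvrStep K s (.comm i k)) = P.dualGap K θ s -
      P.sigmaTilde K * P.rhoComm K * (1 - P.rhoComm K) *
        ‖(s.node i - θ) - (s.token k - θ)‖ ^ 2 := by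
  simp only [dualGap, TokenState.sqDist, tvrStep]
  rw [Finset.sum_apply_update (fun _ u => ‖u - θ‖ ^ 2),
    Finset.sum_apply_update (fun _ u => ‖u - θ‖ ^ 2)]
  have h1 : s.node i + P.rhoComm K • (s.token k - s.node i) - θ =
      (s.node i - θ) - P.rhoComm K • ((s.node i - θ) - (s.token k - θ)) := by module
  have h2 : s.token k - P.rhoComm K • (s.token k - s.node i) - θ =
      (s.token k - θ) + P.rhoComm K • ((s.node i - θ) - (s.token k - θ)) := by module
  rw [h1, h2]
  generalize ∑ i, ‖s.node i - θ‖ ^ 2 = A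
  generalize s.node i - θ = u
  generalize ∑ k, ‖s.token k - θ‖ ^ 2 = B
  generalize s.token k - θ = v
  simp only [norm_sub_sq_real, norm_add_sq_real, norm_smul, mul_pow, real_inner_smul_right,
    inner_sub_right, real_inner_self_eq_norm_sq, Real.norm_eq_abs, sq_abs, real_inner_comm u v]
  ring

/-- A jump changes the Lyapunov function by at most the drift: the quadratic term of the
communication form is absorbed by the decrease of the dual gap. -/
lemma lyapunov_comm_le (hn : 0 < n) (hm : 1 ≤ m) (hK : 0 < K) (hKn : K ≤ n) (hσ : 0 < P.σ)
    (s : TokenState n m K d) (i : Fin n) (k : Fin K) :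
    P.lyapunov K θ (P.tvrStep K s (.comm i k)) ≤ P.lyapunov K θ s + P.drift K θ s (.comm i k) := by
  have hn' : (0 : ℝ) < n := by exact_mod_cast hn
  have hK' : (0 : ℝ) < K := by exact_mod_cast hK
  have hKn' : (K : ℝ) ≤ n := by exact_mod_cast hKn
  have hs := P.sigmaTilde_pos (K := K) hn hσ
  have hκ := P.one_le_kappaS (K := K) hn hσ
  have hC : P.primalGap K θ (P.tvrStep K s (.comm i k)) = P.primalGap K θ s := rfl
  rw [lyapunov, lyapunov, hC, dualGap_comm, nodeResidual_comm, tokenResidual_comm,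
    bipartiteForm_update, drift, P.rhoComm_eq hn hm hK hσ, real_inner_smul_left, norm_smul,
    mul_pow, Real.norm_eq_abs, sq_abs]
  have hD : 0 ≤ ‖s.node i - θ - (s.token k - θ)‖ ^ 2 := by positivity
  generalize ‖s.node i - θ - (s.token k - θ)‖ ^ 2 = D at *
  -- The effective resistance of an edge is at most `2 / K`.
  have hr : (n : ℝ)⁻¹ + (K : ℝ)⁻¹ - ((n : ℝ) * K)⁻¹ ≤ 2 * (K : ℝ)⁻¹ := by
    have h1 : (n : ℝ)⁻¹ ≤ (K : ℝ)⁻¹ := inv_anti₀ hK' hKn'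
    have h2 : 0 ≤ ((n : ℝ) * K)⁻¹ := by positivity
    linarith
  have hα : P.alpha K * (2 * (K : ℝ)⁻¹) * P.sigmaTilde K ≤ 4 := by
    rw [alpha]
    have : 2 * (K : ℝ) / (P.sigmaTilde K * P.kappaS K) * (2 * (K : ℝ)⁻¹) * P.sigmaTilde K =
        4 / P.kappaS K := by
      field_simp
      ring
    rw [this]
    exact div_le_self (by norm_num) hκ
  have hα0 : 0 ≤ P.alpha K := by
    unfold alpha
    positivity
  have h3 : P.alpha K * ((n : ℝ)⁻¹ + (K : ℝ)⁻¹ - ((n : ℝ) * K)⁻¹) * P.sigmaTilde K ≤ 4 :=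
    le_trans (by gcongr) hα
  have h4 := mul_le_mul_of_nonneg_right h3 (mul_nonneg hs.le hD)
  linarith

lemma primalGap_comp (s : TokenState n m K d) (i : Fin n) (j : Fin m) :
    P.primalGap K θ (P.tvrStep K s (.comp i j)) = P.primalGap K θ s +
      (bregman (P.f i j) ((1 - P.rhoComp K i j) • s.z i j + P.rhoComp K i j • s.node i) θ -
        bregman (P.f i j) (s.z i j) θ) := by
  simp only [primalGap, tvrStep]
  rw [Finset.sum_apply_update (X := fun _ => Fin m → EuclideanSpace ℝ (Fin d))
      (fun i u => ∑ j, bregman (P.f i j) (u j) θ),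
    Finset.sum_apply_update (fun j u => bregman (P.f i j) u θ)]
  ring

lemma dualGap_comp (hs : P.sigmaTilde K ≠ 0) (s : TokenState n m K d) (i : Fin n) (j : Fin m)
    (z' : EuclideanSpace ℝ (Fin d))
    (hz : z' = (1 - P.rhoComp K i j) • s.z i j + P.rhoComp K i j • s.node i) :
    P.dualGap K θ (P.tvrStep K s (.comp i j)) = P.dualGap K θ s + bregman (P.f i j) (s.z i j) z' +
      inner ℝ (gradient (P.f i j) z' - gradient (P.f i j) (s.z i j)) (s.z i j - s.node i) +
      (2 * P.sigmaTilde K)⁻¹ * ‖gradient (P.f i j) z' - gradient (P.f i j) (s.z i j)‖ ^ 2 := by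
  simp only [dualGap, TokenState.sqDist, tvrStep, ← hz]
  rw [Finset.sum_apply_update (fun _ u => ‖u - θ‖ ^ 2),
    Finset.sum_apply_update (X := fun _ => Fin m → EuclideanSpace ℝ (Fin d))
      (fun i u => ∑ j, bregman (P.f i j) θ (u j)),
    Finset.sum_apply_update (fun j u => bregman (P.f i j) θ u)]
  have h1 := bregman_sub_bregman_left (P.f i j) (s.z i j) z' θ
  generalize gradient (P.f i j) z' - gradient (P.f i j) (s.z i j) = g at *
  have h2 : s.node i - (P.sigmaTilde K)⁻¹ • g - θ =
    (s.node i - θ) - (P.sigmaTilde K)⁻¹ • g := by abel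
  have h3 : s.z i j - s.node i = (s.z i j - θ) - (s.node i - θ) := by abel
  rw [h2, norm_sub_sq_real, norm_smul, mul_pow, real_inner_smul_right, Real.norm_eq_abs, sq_abs,
    h3, inner_sub_right, real_inner_comm (s.node i - θ)]
  rw [sub_eq_iff_eq_add] at h1
  rw [h1]
  field_simp
  ring

/-- A gradient step changes the Lyapunov function by at most the drift: the divergence between the
new and the old virtual parameter is absorbed by the decrease of the dual gap. -/
lemma lyapunov_comp_le (hP : P.IsRegular) (hn : 0 < n) (hm : 1 ≤ m) (hK : 0 < K)
    (s : TokenState n m K d) (i : Fin n) (j : Fin m) :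
    P.lyapunov K θ (P.tvrStep K s (.comp i j)) ≤ P.lyapunov K θ s + P.drift K θ s (.comp i j) := by
  have hs := P.sigmaTilde_pos (K := K) hn hP.sigma_pos
  have hρ := P.rhoComp_pos hn hm hK hP.sigma_pos i j
  have hρL := P.rhoComp_mul_le hn hm hK hP.sigma_pos i j
  obtain ⟨z', hz⟩ : ∃ z', z' = (1 - P.rhoComp K i j) • s.z i j + P.rhoComp K i j • s.node i :=
    ⟨_, rfl⟩
  rw [lyapunov, lyapunov, nodeResidual_comp hs.ne', tokenResidual_comp, primalGap_comp, ← hz,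
    dualGap_comp hs.ne' s i j z' hz, drift]
  have hzd : z' - s.z i j = -(P.rhoComp K i j • (s.z i j - s.node i)) := by rw [hz]; module
  have h1 := bregman_sub_bregman_right (P.f i j) (s.z i j) z' θ
  have h2 := bregman_add_bregman_swap (P.f i j) z' (s.z i j)
  have h3 := norm_gradient_sub_sq_le (hP.differentiable i j) (hP.convex i j) (hP.smooth i j)
    (s.z i j) z'
  have h4 := bregman_nonneg (hP.differentiable i j) (hP.convex i j) (s.z i j) z'
  have h5 := bregman_nonneg (hP.differentiable i j) (hP.convex i j) z' (s.z i j)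
  rw [hzd, inner_neg_right, real_inner_smul_right] at h1 h2
  rw [norm_sub_rev] at h3
  generalize P.rhoComp K i j = ρ at *
  generalize inner ℝ (gradient (P.f i j) z' - gradient (P.f i j) (s.z i j))
    (s.z i j - s.node i) = I at *
  generalize ‖gradient (P.f i j) z' - gradient (P.f i j) (s.z i j)‖ ^ 2 = G at *
  generalize bregman (P.f i j) (s.z i j) z' = A at *
  generalize bregman (P.f i j) z' (s.z i j) = B at *
  have h6 : 0 ≤ 1 + P.L i j / P.sigmaTilde K := (P.one_add_div_pos hn hP.sigma_pos i j).le
  have h7 : (P.sigmaTilde K)⁻¹ * G ≤ 2 * (P.L i j / P.sigmaTilde K) * A := by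
    calc (P.sigmaTilde K)⁻¹ * G ≤ (P.sigmaTilde K)⁻¹ * (2 * P.L i j * A) := by gcongr
      _ = _ := by ring
  have h8 : (0 : ℝ) ≤ P.L i j / P.sigmaTilde K := by positivity
  generalize (P.L i j : ℝ) / P.sigmaTilde K = l at *
  -- `A + B = -ρ I` by the symmetrized divergence, and `ρ (1 + l) ≤ 1`.
  have h9 : (1 + l) * (A + B) ≤ -I := by
    refine le_of_mul_le_mul_left ?_ hρ
    nlinarith [mul_le_mul_of_nonneg_right hρL (add_nonneg h4 h5)]
  have h10 : 0 ≤ l * B := mul_nonneg h8 h5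
  rw [mul_inv]
  linarith

end FiniteSumProblem

/-! ### Contraction in expectation -/

namespace FiniteSumProblem

variable {n m d K : ℕ} {P : FiniteSumProblem n m d} {θ : EuclideanSpace ℝ (Fin d)}

lemma primalGap_nonneg (hP : P.IsRegular) (s : TokenState n m K d) : 0 ≤ P.primalGap K θ s :=
  Finset.sum_nonneg fun i _ => Finset.sum_nonneg fun j _ =>
    bregman_nonneg (hP.differentiable i j) (hP.convex i j) _ _

lemma sum_bregman_left_nonneg (hP : P.IsRegular) (s : TokenState n m K d) :
    0 ≤ ∑ i, ∑ j, bregman (P.f i j) θ (s.z i j) :=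
  Finset.sum_nonneg fun i _ => Finset.sum_nonneg fun j _ =>
    bregman_nonneg (hP.differentiable i j) (hP.convex i j) _ _

lemma sigmaTilde_mul_sqDist_le_lyapunov (hP : P.IsRegular) (hn : 0 < n)
    (s : TokenState n m K d) : P.sigmaTilde K * s.sqDist θ ≤ P.lyapunov K θ s := by
  have hs := P.sigmaTilde_pos (K := K) hn hP.sigma_pos
  have hκ := P.one_le_kappaS (K := K) hn hP.sigma_pos
  have h1 := P.primalGap_nonneg (θ := θ) hP s
  have h2 := P.sum_bregman_left_nonneg (θ := θ) hP s
  have h3 : 0 ≤ P.alpha K / 2 *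
      bipartiteForm (P.nodeResidual K θ s) (P.tokenResidual K θ s) := by
    refine mul_nonneg ?_ (bipartiteForm_nonneg _ _)
    unfold alpha
    positivity
  rw [lyapunov, dualGap]
  linarith

/-- Cauchy–Schwarz with weights `σ̃` and `L i j`, whose sum is at most `σ̃ κ_s`; cocoercivity bounds
the gradient differences. -/
lemma norm_nodeResidual_sq_le (hP : P.IsRegular) (hn : 0 < n) (s : TokenState n m K d)
    (i : Fin n) :
    ‖P.nodeResidual K θ s i‖ ^ 2 ≤ P.sigmaTilde K * P.kappaS K *
      (P.sigmaTilde K * ‖s.node i - θ‖ ^ 2 + 2 * ∑ j, bregman (P.f i j) (s.z i j) θ) := by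
  have hs := P.sigmaTilde_pos (K := K) hn hP.sigma_pos
  have hb (j : Fin m) : 0 ≤ bregman (P.f i j) (s.z i j) θ :=
    bregman_nonneg (hP.differentiable i j) (hP.convex i j) _ _
  have h1 := norm_smul_add_sum_sq_le hs.le (s.node i - θ)
    (fun j => gradient (P.f i j) (s.z i j) - gradient (P.f i j) θ) (fun j => (P.L i j : ℝ))
    (fun j => 2 * bregman (P.f i j) (s.z i j) θ) (fun j => (P.L i j).coe_nonneg)
    (fun j => mul_nonneg zero_le_two (hb j)) (fun j => by
      have := norm_gradient_sub_sq_le (hP.differentiable i j) (hP.convex i j) (hP.smooth i j)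
        (s.z i j) θ
      linarith)
  have h2 : P.sigmaTilde K + ∑ j, (P.L i j : ℝ) ≤ P.sigmaTilde K * P.kappaS K := by
    have := mul_le_mul_of_nonneg_left (P.one_add_sum_le_kappaS (K := K) i) hs.le
    rwa [mul_add, mul_one, Finset.mul_sum,
      Finset.sum_congr rfl fun j _ => mul_div_cancel₀ (P.L i j : ℝ) hs.ne'] at this
  rw [← Finset.mul_sum] at h1
  refine h1.trans (mul_le_mul_of_nonneg_right h2 ?_)
  have := Finset.sum_nonneg fun j (_ : j ∈ Finset.univ) => hb j
  positivity

/-- The mirror geometry is dominated by the primal distances. This is where the choice of `α`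
enters. -/
lemma alpha_mul_bipartiteForm_le (hP : P.IsRegular) (hn : 0 < n) (hK : 0 < K) (hKn : K ≤ n)
    (s : TokenState n m K d) :
    P.alpha K / 2 * bipartiteForm (P.nodeResidual K θ s) (P.tokenResidual K θ s) ≤
      P.sigmaTilde K * s.sqDist θ + 2 * P.primalGap K θ s := by
  have hs := P.sigmaTilde_pos (K := K) hn hP.sigma_pos
  have hκ := P.one_le_kappaS (K := K) hn hP.sigma_pos
  have hK' : (0 : ℝ) < K := by exact_mod_cast hK
  have h1 := bipartiteForm_le hK hKn (P.nodeResidual K θ s) (P.tokenResidual K θ s)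
  have h2 := Finset.sum_le_sum fun i (_ : i ∈ Finset.univ) =>
    P.norm_nodeResidual_sq_le (K := K) (θ := θ) hP hn s i
  have h3 : ∑ k, ‖P.tokenResidual K θ s k‖ ^ 2 ≤
      P.sigmaTilde K * P.kappaS K * (P.sigmaTilde K * ∑ k, ‖s.token k - θ‖ ^ 2) := by
    rw [Finset.mul_sum, Finset.mul_sum]
    refine Finset.sum_le_sum fun k _ => ?_
    rw [tokenResidual, norm_smul, mul_pow, Real.norm_eq_abs, sq_abs]
    have h4 : 0 ≤ P.sigmaTilde K ^ 2 * ‖s.token k - θ‖ ^ 2 := by positivity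
    nlinarith [mul_le_mul_of_nonneg_right hκ h4]
  rw [← Finset.mul_sum, Finset.sum_add_distrib, ← Finset.mul_sum, ← Finset.mul_sum] at h2
  have h5 : bipartiteForm (P.nodeResidual K θ s) (P.tokenResidual K θ s) ≤
      P.sigmaTilde K * P.kappaS K *
        (P.sigmaTilde K * s.sqDist θ + 2 * P.primalGap K θ s) / K := by
    refine h1.trans (div_le_div_of_nonneg_right ?_ hK'.le)
    rw [TokenState.sqDist, primalGap]
    linarith
  calc _ ≤ P.alpha K / 2 * (P.sigmaTilde K * P.kappaS K *
        (P.sigmaTilde K * s.sqDist θ + 2 * P.primalGap K θ s) / K) := by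
          refine mul_le_mul_of_nonneg_left h5 ?_
          unfold alpha
          positivity
    _ = _ := by
      rw [alpha]
      have := hκ.trans_lt' zero_lt_one
      field_simp

/-- The expected drift: the coupling terms between nodes and virtual parameters cancel. -/
lemma sum_actionProb_mul_drift (hn : 0 < n) (hm : 1 ≤ m) (hK : 0 < K) (hσ : 0 < P.σ)
    {s : TokenState n m K d} (hbal : P.Balanced K θ s) :
    ∑ a, P.actionProb K a * P.drift K θ s a = -(P.alpha K * P.eta K *
      (P.sigmaTilde K * s.sqDist θ + ∑ i, ∑ j, bregman (P.f i j) θ (s.z i j)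
        + P.primalGap K θ s)) := by
  have hs := P.sigmaTilde_pos (K := K) hn hσ
  have hn' : (0 : ℝ) < n := by exact_mod_cast hn
  have hK' : (0 : ℝ) < K := by exact_mod_cast hK
  have h1 (x : ℝ) : P.pComm K / (n * K) * (P.alpha K * P.rhoComm K * P.sigmaTilde K * x) =
      P.alpha K * P.eta K * x := by
    have := P.pComm_pos (K := K) hn hm hσ
    rw [rhoComm]
    field_simp
  have h2 (i : Fin n) (j : Fin m) (x : ℝ) :
      P.pComp K / n * P.componentProb K i j * (P.rhoComp K i j * x) =
        P.alpha K * P.eta K * x := by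
    have := P.pComp_pos (K := K) hn hm hσ
    have := P.componentProb_pos (K := K) hn hσ i j
    rw [rhoComp]
    field_simp
  rw [TokenAction.sum_eq]
  simp only [actionProb, drift]
  simp only [h1, mul_neg, h2, ← Finset.mul_sum, Finset.sum_neg_distrib]
  rw [sum_inner_bipartite hn.ne' hK.ne' (P.nodeResidual K θ s) (fun i => s.node i - θ)
    (P.tokenResidual K θ s) (fun k => s.token k - θ) hbal]
  have h3 : ∑ k, inner ℝ (s.token k - θ) (P.tokenResidual K θ s k) =
      P.sigmaTilde K * ∑ k, ‖s.token k - θ‖ ^ 2 := by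
    rw [Finset.mul_sum]
    refine Finset.sum_congr rfl fun k _ => ?_
    rw [tokenResidual, real_inner_smul_right, real_inner_self_eq_norm_sq]
  have h4 : ∑ i, inner ℝ (s.node i - θ) (P.nodeResidual K θ s i) +
      ∑ i, ∑ j, inner ℝ (gradient (P.f i j) (s.z i j) - gradient (P.f i j) θ)
        (s.z i j - s.node i) =
      P.sigmaTilde K * ∑ i, ‖s.node i - θ‖ ^ 2 + ∑ i, ∑ j, bregman (P.f i j) θ (s.z i j)
        + P.primalGap K θ s := by
    rw [Finset.mul_sum, primalGap]
    simp only [← Finset.sum_add_distrib]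
    refine Finset.sum_congr rfl fun i _ => ?_
    rw [nodeResidual, inner_add_right, real_inner_smul_right, real_inner_self_eq_norm_sq, inner_sum]
    simp only [add_assoc, ← Finset.sum_add_distrib]
    congr 1
    refine Finset.sum_congr rfl fun j _ => ?_
    rw [add_comm (bregman _ _ _), bregman_add_bregman_swap, real_inner_comm _ (s.node i - θ),
      ← inner_add_right]
    congr 1
    abel
  rw [h3, TokenState.sqDist]
  linear_combination (-(P.alpha K * P.eta K)) * h4

/-- In expectation, one step contracts the Lyapunov function by `1 - α η / 3`. -/
lemma sum_actionProb_mul_lyapunov_le (hP : P.IsRegular) (hm : 1 ≤ m) (hK : 0 < K)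
    (hKn : K ≤ n) {s : TokenState n m K d} (hbal : P.Balanced K θ s) :
    ∑ a, P.actionProb K a * P.lyapunov K θ (P.tvrStep K s a) ≤
      (1 - P.alpha K * P.eta K / 3) * P.lyapunov K θ s := by
  have hn : 0 < n := hK.trans_le hKn
  have hσ := hP.sigma_pos
  have hκ := P.one_le_kappaS (K := K) hn hσ
  have hm' : (1 : ℝ) ≤ m := by exact_mod_cast hm
  have h1 (a : TokenAction n m K) :
      P.lyapunov K θ (P.tvrStep K s a) ≤ P.lyapunov K θ s + P.drift K θ s a := by
    cases a with
    | comm i k => exact lyapunov_comm_le hn hm hK hKn hσ s i k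
    | comp i j => exact lyapunov_comp_le hP hn hm hK s i j
  have h2 : 0 ≤ P.alpha K * P.eta K := by
    rw [P.alpha_mul_eta hn hm hK hσ]
    have : 0 ≤ (m : ℝ) - 1 + 2 * P.kappaS K := by linarith
    positivity
  have h3 := P.alpha_mul_bipartiteForm_le (θ := θ) hP hn hK hKn s
  have h4 := P.sum_bregman_left_nonneg (θ := θ) hP s
  have h5 : 0 ≤ P.sigmaTilde K * s.sqDist θ := by
    have := P.sigmaTilde_pos (K := K) hn hσ
    unfold TokenState.sqDist
    positivity
  calc _ ≤ ∑ a, P.actionProb K a * (P.lyapunov K θ s + P.drift K θ s a) :=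
        Finset.sum_le_sum fun a _ =>
          mul_le_mul_of_nonneg_left (h1 a) (P.actionProb_nonneg hn hm hσ a)
    _ = P.lyapunov K θ s - P.alpha K * P.eta K *
          (P.sigmaTilde K * s.sqDist θ + ∑ i, ∑ j, bregman (P.f i j) θ (s.z i j)
            + P.primalGap K θ s) := by
        simp only [mul_add, Finset.sum_add_distrib, ← Finset.sum_mul,
          P.sum_actionProb hn hm hK hσ, one_mul]
        rw [P.sum_actionProb_mul_drift hn hm hK hσ hbal]
        ring
    _ ≤ _ := by
        have h6 : P.lyapunov K θ s ≤ 3 * (P.sigmaTilde K * s.sqDist θ +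
            ∑ i, ∑ j, bregman (P.f i j) θ (s.z i j) + P.primalGap K θ s) := by
          rw [lyapunov, dualGap]
          linarith
        linarith [mul_le_mul_of_nonneg_left h6 h2]

/-! ### Optimality and the initial state -/

/-- First-order optimality of the minimizer. -/
lemma sum_gradient_add_smul_eq_zero (hP : P.IsRegular) (hθ : IsMinOn P.objective Set.univ θ) :
    ∑ i, ∑ j, gradient (P.f i j) θ + ((n : ℝ) * P.σ) • θ = 0 := by
  have hd : HasFDerivAt P.objective (∑ i, ((∑ j, fderiv ℝ (P.f i j) θ) +
      (P.σ / 2) • ((2 : ℕ) • innerSL ℝ θ))) θ := by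
    refine HasFDerivAt.fun_sum fun i _ => ?_
    refine (HasFDerivAt.fun_sum fun j _ => (hP.differentiable i j θ).hasFDerivAt).add ?_
    exact ((hasStrictFDerivAt_norm_sq θ).hasFDerivAt.const_mul (P.σ / 2))
  have h0 := (hθ.isLocalMin Filter.univ_mem).hasFDerivAt_eq_zero hd
  refine ext_inner_right ℝ fun v => ?_
  have h1 := congrArg (fun φ => φ v) h0
  simp only [sum_apply, add_apply,
    smul_apply, zero_apply, innerSL_apply_apply,
    Finset.sum_add_distrib, Finset.sum_const, Finset.card_univ, Fintype.card_fin, nsmul_eq_mul,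
    smul_eq_mul, Nat.cast_ofNat] at h1
  simp only [sum_inner, inner_add_left, real_inner_smul_left, inner_gradient_left, inner_zero_left]
  linarith

lemma balanced_tvrInit (hP : P.IsRegular) (hn : 0 < n) (hθ : IsMinOn P.objective Set.univ θ)
    (z₀ : Fin n → Fin m → EuclideanSpace ℝ (Fin d)) :
    P.Balanced K θ (P.tvrInit K z₀) := by
  have hs := P.sigmaTilde_pos (K := K) hn hP.sigma_pos
  have h1 := P.sum_gradient_add_smul_eq_zero hP hθ
  rw [← P.add_mul_sigmaTilde (K := K) hn] at h1
  have h2 (i : Fin n) : P.nodeResidual K θ (P.tvrInit K z₀) i =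
      -(∑ j, gradient (P.f i j) θ) - P.sigmaTilde K • θ := by
    simp only [nodeResidual, tvrInit, smul_sub, smul_neg, smul_inv_smul₀ hs.ne',
      Finset.sum_sub_distrib]
    abel
  rw [Balanced, Finset.sum_congr rfl fun i _ => h2 i]
  simp only [tokenResidual, tvrInit, zero_sub, smul_neg, Finset.sum_sub_distrib,
    Finset.sum_neg_distrib, Finset.sum_const, Finset.card_univ, Fintype.card_fin,
    ← Nat.cast_smul_eq_nsmul ℝ]
  rw [← neg_eq_zero, ← h1]
  module

lemma balanced_tvr (hP : P.IsRegular) (hn : 0 < n) (hθ : IsMinOn P.objective Set.univ θ)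
    (z₀ : Fin n → Fin m → EuclideanSpace ℝ (Fin d)) (a : ℕ → TokenAction n m K) (t : ℕ) :
    P.Balanced K θ (P.tvr K z₀ a t) := by
  induction t with
  | zero => exact balanced_tvrInit hP hn hθ z₀
  | succ t ih => exact ih.tvrStep (P.sigmaTilde_pos hn hP.sigma_pos).ne' (a t)

end FiniteSumProblem

/-! ### Expectations over independent actions -/

instance (n m K : ℕ) : DiscreteMeasurableSpace (TokenAction n m K) := ⟨fun _ => trivial⟩

/-- Averaging out a finitely valued random variable that is independent of another one. -/
lemma integral_eq_sum_of_indepFun {Ω α β : Type*} [MeasurableSpace Ω] {μ : Measure Ω}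
    [IsProbabilityMeasure μ] [Finite α] [MeasurableSpace α] [DiscreteMeasurableSpace α]
    [Fintype β] [MeasurableSpace β] [DiscreteMeasurableSpace β] {X : Ω → α} {Y : Ω → β}
    (hX : Measurable X) (hY : Measurable Y) (hXY : IndepFun X Y μ) (H : α → β → ℝ) :
    ∫ ω, H (X ω) (Y ω) ∂μ = ∑ b, μ.real (Y ⁻¹' {b}) * ∫ ω, H (X ω) b ∂μ := by
  classical
  have h1 (ω : Ω) : H (X ω) (Y ω) = ∑ b, H (X ω) b * (if Y ω = b then 1 else 0) := by simp
  have hprod (b : β) : Integrable (fun ω => H (X ω) b * (if Y ω = b then 1 else 0)) μ :=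
    (Integrable.of_finite (f := fun p : α × β =>
      H p.1 b * (if p.2 = b then 1 else 0))).comp_measurable (hX.prodMk hY)
  simp only [h1]
  rw [integral_finsetSum _ fun b _ => hprod b]
  refine Finset.sum_congr rfl fun b _ => ?_
  have h2 := hXY.integral_fun_comp_mul_comp (f := fun x => H x b)
    (g := fun y => if y = b then (1 : ℝ) else 0) hX.aemeasurable hY.aemeasurable
    Measurable.of_discrete.aestronglyMeasurable Measurable.of_discrete.aestronglyMeasurable
  have h3 : ∫ ω, (if Y ω = b then (1 : ℝ) else 0) ∂μ = μ.real (Y ⁻¹' {b}) := by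
    rw [← integral_indicator_one (hY (MeasurableSet.of_discrete (s := {b})))]
    rfl
  rw [h2, h3, mul_comm]

namespace IsIIDActions

variable {n m K : ℕ} {Ω : Type*} [MeasurableSpace Ω] {μ : Measure Ω}
  {S : ℕ → Ω → TokenAction n m K} {q : TokenAction n m K → ℝ}

lemma integral_eq_sum [IsProbabilityMeasure μ] (hS : IsIIDActions μ S q) (t : ℕ)
    (g : TokenAction n m K → ℝ) :
    ∫ ω, g (S t ω) ∂μ = ∑ a, q a * g a := by
  have h := integral_eq_sum_of_indepFun (X := fun _ : Ω => ()) measurable_const (hS.measurable t)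
    (indepFun_const_left (μ := μ) () (S t)) (fun _ a => g a)
  simpa [hS.law t] using h

lemma measurable_history (hS : IsIIDActions μ S q) (t : ℕ) :
    Measurable fun ω (s : Finset.range t) => S s ω :=
  measurable_pi_lambda _ fun s => hS.measurable s

lemma indepFun_history (hS : IsIIDActions μ S q) (t : ℕ) :
    IndepFun (fun ω (s : Finset.range t) => S s ω) (S t) μ := by
  have h := hS.indep.indepFun_finset (Finset.range t) {t} (by simp) hS.measurable
  exact h.comp measurable_id (measurable_pi_apply (⟨t, by simp⟩ : ({t} : Finset ℕ)))

lemma integral_card_filter [IsProbabilityMeasure μ] (hS : IsIIDActions μ S q) (T : ℕ)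
    (p : TokenAction n m K → Prop) [DecidablePred p] :
    ∫ ω, (((Finset.range T).filter fun t => p (S t ω)).card : ℝ) ∂μ =
      T * ∑ a, q a * (if p a then 1 else 0) := by
  simp only [Finset.card_filter, Nat.cast_sum, Nat.cast_ite, Nat.cast_one, Nat.cast_zero]
  rw [integral_finsetSum]
  · rw [Finset.sum_congr rfl fun t _ =>
      hS.integral_eq_sum t fun a => if p a then (1 : ℝ) else 0]
    simp
  · exact fun t _ => (Integrable.of_finite (f := fun a : TokenAction n m K =>
      if p a then (1 : ℝ) else 0)).comp_measurable (hS.measurable t)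

end IsIIDActions

namespace FiniteSumProblem

variable {n m d K : ℕ} {P : FiniteSumProblem n m d} {θ : EuclideanSpace ℝ (Fin d)}

/-- The state at time `t` is a function of the first `t` actions. -/
lemma exists_tvr_eq (z₀ : Fin n → Fin m → EuclideanSpace ℝ (Fin d)) (t : ℕ) :
    ∃ H : (Finset.range t → TokenAction n m K) → TokenState n m K d,
      ∀ a : ℕ → TokenAction n m K, P.tvr K z₀ a t = H fun s => a s := by
  induction t with
  | zero => exact ⟨fun _ => P.tvrInit K z₀, fun _ => rfl⟩
  | succ t ih =>
    obtain ⟨H, hH⟩ := ih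
    refine ⟨fun h => P.tvrStep K
      (H fun s => h ⟨s, Finset.mem_range.2 ((Finset.mem_range.1 s.2).trans t.lt_succ_self)⟩)
      (h ⟨t, Finset.self_mem_range_succ t⟩), fun a => ?_⟩
    rw [tvr, hH]

section Expectation

variable {Ω : Type*} [MeasurableSpace Ω] {μ : Measure Ω} [IsProbabilityMeasure μ]
  {S : ℕ → Ω → TokenAction n m K} {q : TokenAction n m K → ℝ}

lemma integrable_tvr (hS : IsIIDActions μ S q)
    (z₀ : Fin n → Fin m → EuclideanSpace ℝ (Fin d)) (G : TokenState n m K d → ℝ) (t : ℕ) :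
    Integrable (fun ω => G (P.tvr K z₀ (fun s => S s ω) t)) μ := by
  obtain ⟨H, hH⟩ := P.exists_tvr_eq (K := K) z₀ t
  simp only [hH]
  exact (Integrable.of_finite (f := fun h => G (H h))).comp_measurable (hS.measurable_history t)

/-- The Markov property of the algorithm, in expectation. -/
lemma integral_tvr_succ (hS : IsIIDActions μ S q)
    (z₀ : Fin n → Fin m → EuclideanSpace ℝ (Fin d)) (G : TokenState n m K d → ℝ) (t : ℕ) :
    ∫ ω, G (P.tvr K z₀ (fun s => S s ω) (t + 1)) ∂μ =
      ∫ ω, ∑ a, q a * G (P.tvrStep K (P.tvr K z₀ (fun s => S s ω) t) a) ∂μ := by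
  rw [integral_finsetSum _ fun a _ =>
    (integrable_tvr hS z₀ (fun s => G (P.tvrStep K s a)) t).const_mul (q a)]
  obtain ⟨H, hH⟩ := P.exists_tvr_eq (K := K) z₀ t
  simp only [tvr, hH, integral_const_mul]
  rw [integral_eq_sum_of_indepFun (hS.measurable_history t) (hS.measurable t)
    (hS.indepFun_history t) fun h a => G (P.tvrStep K (H h) a)]
  simp only [hS.law t]

lemma integral_lyapunov_le (hP : P.IsRegular) (hm : 1 ≤ m) (hK : 0 < K) (hKn : K ≤ n)
    (hθ : IsMinOn P.objective Set.univ θ) (hS : IsIIDActions μ S (P.actionProb K))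
    (z₀ : Fin n → Fin m → EuclideanSpace ℝ (Fin d)) (hr : P.alpha K * P.eta K ≤ 3) (t : ℕ) :
    ∫ ω, P.lyapunov K θ (P.tvr K z₀ (fun s => S s ω) t) ∂μ ≤
      (1 - P.alpha K * P.eta K / 3) ^ t * P.lyapunov K θ (P.tvrInit K z₀) := by
  induction t with
  | zero => simp [tvr]
  | succ t ih =>
    rw [integral_tvr_succ hS]
    calc _ ≤ ∫ ω, (1 - P.alpha K * P.eta K / 3) *
          P.lyapunov K θ (P.tvr K z₀ (fun s => S s ω) t) ∂μ := by
          refine integral_mono (integrable_tvr hS z₀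
            (fun s => ∑ a, P.actionProb K a * P.lyapunov K θ (P.tvrStep K s a)) t)
            ((integrable_tvr hS z₀ _ t).const_mul _) fun ω => ?_
          exact sum_actionProb_mul_lyapunov_le hP hm hK hKn
            (balanced_tvr hP (hK.trans_le hKn) hθ z₀ _ t)
      _ ≤ _ := by
          rw [integral_const_mul, pow_succ', mul_assoc]
          exact mul_le_mul_of_nonneg_left ih (by linarith)

lemma integral_gradientSteps (hm : 1 ≤ m) (hn : 0 < n) (hσ : 0 < P.σ)
    (hS : IsIIDActions μ S (P.actionProb K)) (i : Fin n) (T : ℕ) :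
    ∫ ω, (gradientSteps (fun s => S s ω) i T : ℝ) ∂μ = T * (P.pComp K / n) := by
  classical
  have h := hS.integral_card_filter T fun a => ∃ j, a = .comp i j
  rw [TokenAction.sum_eq] at h
  simp only [reduceCtorEq, exists_false, if_false, mul_zero, Finset.sum_const_zero, zero_add,
    TokenAction.comp.injEq, exists_and_left, exists_eq', and_true, mul_ite, mul_one, actionProb]
    at h
  rw [Finset.sum_eq_single i (fun i' _ hi => by simp [hi]) (by simp)] at h
  simp only [if_true, ← Finset.mul_sum, P.sum_componentProb hn hm hσ, mul_one] at h
  rw [← h]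
  unfold gradientSteps
  congr!

lemma integral_tokenJumps (hn : 0 < n) (hS : IsIIDActions μ S (P.actionProb K)) (k : Fin K)
    (T : ℕ) :
    ∫ ω, (tokenJumps (fun s => S s ω) k T : ℝ) ∂μ = T * (P.pComm K / K) := by
  classical
  have hn' : (n : ℝ) ≠ 0 := by exact_mod_cast hn.ne'
  have h := hS.integral_card_filter T fun a => ∃ i, a = .comm i k
  rw [TokenAction.sum_eq] at h
  simp only [reduceCtorEq, exists_false, if_false, mul_zero, Finset.sum_const_zero, add_zero,
    TokenAction.comm.injEq, exists_and_right, exists_eq', true_and, mul_ite, mul_one, actionProb,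
    Finset.sum_ite_eq', Finset.mem_univ, if_true, Finset.sum_const, Finset.card_univ,
    Fintype.card_fin, nsmul_eq_mul] at h
  have h2 : (n : ℝ) * (P.pComm K / (n * K)) = P.pComm K / K := by field_simp
  rw [← h2, ← h]
  unfold tokenJumps
  congr!

end Expectation

end FiniteSumProblem

/-! ### Convergence -/

theorem theorem3 :
    ∃ c : ℝ, 0 < c ∧
      ∀ (n m K d : ℕ), 1 ≤ m → 1 ≤ K → K ≤ n →
      ∀ P : FiniteSumProblem n m d, P.IsRegular →
      ∀ θstar : EuclideanSpace ℝ (Fin d), IsMinOn P.objective Set.univ θstar →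
      ∀ z₀ : Fin n → Fin m → EuclideanSpace ℝ (Fin d),
      ∃ C₀ : ℝ, 1 ≤ C₀ ∧
      ∀ ε : ℝ, 0 < ε → ε < 1 →
      ∃ T : ℕ,
      ∀ (Ω : Type*) [MeasurableSpace Ω] (μ : Measure Ω) [IsProbabilityMeasure μ]
        (S : ℕ → Ω → TokenAction n m K), IsIIDActions μ S (P.actionProb K) →
        (∀ t, T ≤ t → ∫ ω, (P.tvr K z₀ (fun s => S s ω) t).sqDist θstar ∂μ ≤ ε) ∧
        (∀ i : Fin n, ∫ ω, (gradientSteps (fun s => S s ω) i T : ℝ) ∂μ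
          ≤ c * (m + P.kappaS K) * Real.log (C₀ / ε)) ∧
        (∀ k : Fin K, ∫ ω, (tokenJumps (fun s => S s ω) k T : ℝ) ∂μ
          ≤ c * (n / K * P.kappaS K) * Real.log (C₀ / ε)) := by
  refine ⟨4, by norm_num, ?_⟩
  intro n m K d hm hK hKn P hP θ hθ z₀
  have hK0 : 0 < K := hK
  have hn : 0 < n := hK0.trans_le hKn
  have hn' : (1 : ℝ) ≤ n := by exact_mod_cast hn
  have hm' : (1 : ℝ) ≤ m := by exact_mod_cast hm
  have hK' : (0 : ℝ) < K := by exact_mod_cast hK0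
  have hσ := hP.sigma_pos
  have hs := P.sigmaTilde_pos (K := K) hn hσ
  have hκ := P.one_le_kappaS (K := K) hn hσ
  have hpComp := P.pComp_eq (K := K) hn hm hσ
  have hpComm := P.pComm_eq (K := K) hn hm hσ
  have hbpos : 0 < (m : ℝ) - 1 + 2 * P.kappaS K := by linarith
  have hb1 : 1 ≤ n * ((m : ℝ) - 1 + 2 * P.kappaS K) := by nlinarith
  have hr : P.alpha K * P.eta K = (n * ((m : ℝ) - 1 + 2 * P.kappaS K))⁻¹ :=
    P.alpha_mul_eta hn hm hK0 hσ
  have hr1 : P.alpha K * P.eta K ≤ 1 := hr ▸ inv_le_one_of_one_le₀ hb1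
  have hr0 : 0 < P.alpha K * P.eta K := by
    rw [hr]
    positivity
  set Ψ := P.lyapunov K θ (P.tvrInit K z₀)
  have hΨ : 0 ≤ Ψ := by
    refine le_trans (mul_nonneg hs.le ?_) (P.sigmaTilde_mul_sqDist_le_lyapunov hP hn _)
    unfold TokenState.sqDist
    positivity
  have hΨs : 0 ≤ Ψ / P.sigmaTilde K := by positivity
  have he : (1 : ℝ) ≤ Real.exp 1 := Real.one_le_exp zero_le_one
  -- The summand `exp 1` makes the logarithm at least `1`, which pays for rounding `T` up.
  refine ⟨Real.exp 1 + Ψ / P.sigmaTilde K, by linarith, fun ε hε hε1 => ?_⟩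
  set C := Real.exp 1 + Ψ / P.sigmaTilde K with hC
  have hCpos : 0 < C := by linarith
  set l := Real.log (C / ε) with hl
  have hl1 : 1 ≤ l := by
    rw [hl, Real.le_log_iff_exp_le (by positivity), le_div_iff₀ hε]
    nlinarith
  refine ⟨⌈l / (P.alpha K * P.eta K / 3)⌉₊, ?_⟩
  intro Ω _ μ _ S hS
  -- Since `1 ≤ l`, rounding up costs at most one more multiple of `n (m - 1 + 2 κ) l`.
  have hT : (⌈l / (P.alpha K * P.eta K / 3)⌉₊ : ℝ) ≤
      4 * (n * ((m : ℝ) - 1 + 2 * P.kappaS K)) * l := by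
    have h1 := (Nat.ceil_lt_add_one (a := l / (P.alpha K * P.eta K / 3)) (by positivity)).le
    have h2 : l / (P.alpha K * P.eta K / 3) = 3 * (n * ((m : ℝ) - 1 + 2 * P.kappaS K)) * l := by
      rw [hr]
      field_simp
    rw [h2] at h1
    rw [h2]
    nlinarith
  refine ⟨fun t ht => ?_, fun i => ?_, fun k => ?_⟩
  · have h1 := FiniteSumProblem.integral_lyapunov_le hP hm hK0 hKn hθ hS z₀ (by linarith) t
    have h2 : P.sigmaTilde K * ∫ ω, (P.tvr K z₀ (fun s => S s ω) t).sqDist θ ∂μ ≤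
        ∫ ω, P.lyapunov K θ (P.tvr K z₀ (fun s => S s ω) t) ∂μ := by
      rw [← integral_const_mul]
      exact integral_mono
        ((FiniteSumProblem.integrable_tvr hS z₀ (fun s => s.sqDist θ) t).const_mul _)
        (FiniteSumProblem.integrable_tvr hS z₀ _ t)
        fun ω => P.sigmaTilde_mul_sqDist_le_lyapunov hP hn _
    have h3 : (1 - P.alpha K * P.eta K / 3) ^ t ≤ ε / C := by
      have h4 : l ≤ P.alpha K * P.eta K / 3 * t := by
        have := (Nat.le_ceil _).trans (Nat.cast_le (α := ℝ).2 ht)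
        rwa [div_le_iff₀' (by positivity)] at this
      calc (1 - P.alpha K * P.eta K / 3) ^ t
          ≤ Real.exp (-(P.alpha K * P.eta K / 3)) ^ t := by
            refine pow_le_pow_left₀ (by linarith) ?_ t
            linarith [Real.add_one_le_exp (-(P.alpha K * P.eta K / 3))]
        _ = Real.exp (-(P.alpha K * P.eta K / 3 * t)) := by
            rw [← Real.exp_nat_mul]
            ring_nf
        _ ≤ Real.exp (-l) := Real.exp_le_exp.2 (by linarith)
        _ = ε / C := by rw [Real.exp_neg, hl, Real.exp_log (by positivity), inv_div]
    have h5 : P.sigmaTilde K * ∫ ω, (P.tvr K z₀ (fun s => S s ω) t).sqDist θ ∂μ ≤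
        P.sigmaTilde K * ε := by
      refine (h2.trans h1).trans ((mul_le_mul_of_nonneg_right h3 hΨ).trans ?_)
      have h6 : Ψ ≤ P.sigmaTilde K * C := by
        rw [hC, mul_add, mul_div_cancel₀ _ hs.ne']
        have := mul_pos hs (zero_lt_one.trans_le he)
        linarith
      rw [div_mul_eq_mul_div, div_le_iff₀ hCpos]
      nlinarith
    exact le_of_mul_le_mul_left h5 hs
  · rw [FiniteSumProblem.integral_gradientSteps hm hn hσ hS]
    have h1 : 0 ≤ P.pComp K / n := by
      have := P.pComp_pos (K := K) hn hm hσ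
      positivity
    calc _ ≤ 4 * (n * ((m : ℝ) - 1 + 2 * P.kappaS K)) * l * (P.pComp K / n) :=
          mul_le_mul_of_nonneg_right hT h1
      _ = 4 * ((m : ℝ) - 1 + P.kappaS K) * l := by
          rw [hpComp]
          generalize (m : ℝ) - 1 + 2 * P.kappaS K = b at *
          field_simp
      _ ≤ _ := by
          gcongr
          linarith
  · rw [FiniteSumProblem.integral_tokenJumps hn hS]
    have h1 : 0 ≤ P.pComm K / K := by
      have := P.pComm_pos (K := K) hn hm hσ
      positivity
    calc _ ≤ 4 * (n * ((m : ℝ) - 1 + 2 * P.kappaS K)) * l * (P.pComm K / K) :=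
          mul_le_mul_of_nonneg_right hT h1
      _ = _ := by
          rw [hpComm]
          generalize (m : ℝ) - 1 + 2 * P.kappaS K = b at *
          field_simp
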